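/- Let $n\ge 4$. Let $\mathcal K(\mathbb R^n)$ be the set of convex bodies (non-empty, compact, convex subsets of $\mathbb R^n$), and for $K\in\mathcal K(\mathbb R^n)$ let $h_K(y)=\sup_{x\in K}\langle y,x\rangle$ be its support function, restricted to the unit sphere $\mathrm S^{n-1}$, and $S_{n-1}(K,\cdot)$ its surface area measure on $\mathrm S^{n-1}$. Put $$\mu_{n-1}(K)=\int_{\mathrm S^{n-1}}x_1^3\,dS_{n-1}(K,x),\qquad K\in\mathcal K(\mathbb R^n).$$ Let $\mathrm{Lip}(\mathrm S^{n-1})$ be the space of real-valued Lipschitz functions on $\mathrm S^{n-1}$. A sequence $(f_j)$ in $\mathrm{Lip}(\mathrm S^{n-1})$ is said to $\tau$-converge to $f\in\mathrm{Lip}(\mathrm S^{n-1})$ if $f_j\to f$ uniformly, the spherical gradients satisfy $\nabla f_j\to\nabla f$ $\mathcal H^{n-1}$-almost everywhere, and $\sup_j\|\nabla f_j\|_{L^\infty(\mathrm S^{n-1})}<\infty$. Equip $\mathrm{Lip}(\mathrm S^{n-1})$ with the topology whose open sets are the sets $O$ such that every sequence $\tau$-converging to a point of $O$ is eventually in $O$.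 Let $\mathrm{Val}_{n-1}(\mathrm{Lip}(\mathrm S^{n-1}))$ be the set of continuous maps $\nu:\mathrm{Lip}(\mathrm S^{n-1})\to\mathbb C$ such that, for all $f,h\in\mathrm{Lip}(\mathrm S^{n-1})$, every linear $\lambda:\mathbb R^n\to\mathbb R$ and every $t\ge0$, $$\nu(f\vee h)+\nu(f\wedge h)=\nu(f)+\nu(h),\qquad \nu(f+\lambda|_{\mathrm S^{n-1}})=\nu(f),\qquad \nu(tf)=t^{n-1}\nu(f),$$ where $f\vee h$ and $f\wedge h$ are the pointwise maximum and minimum. Then there exists no $\nu\in\mathrm{Val}_{n-1}(\mathrm{Lip}(\mathrm S^{n-1}))$ such that $\nu(h_K)=\mu_{n-1}(K)$ for all $K\in\mathcal K(\mathbb R^n)$. -/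

import Mathlib

open MeasureTheory Filter Topology
open scoped NNReal ENNReal RealInnerProductSpace

noncomputable section

namespace LipVal

/-- Euclidean space `ℝⁿ`. -/
abbrev E (n : ℕ) : Type := EuclideanSpace ℝ (Fin n)

/-- The unit sphere `S^{n-1}` of `ℝⁿ`, with the metric induced by the Euclidean norm. -/
abbrev S (n : ℕ) : Type := Metric.sphere (0 : E n) 1

/-! ### Lipschitz functions on the sphere -/

/-- The space `Lip(S^{n-1})` of real-valued Lipschitz functions on the unit sphere. -/
@[ext]
structure Lip (n : ℕ) where
  toFun : S n → ℝ
  lipschitz : ∃ C : ℝ≥0, LipschitzWith C toFun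

instance (n : ℕ) : CoeFun (Lip n) (fun _ => S n → ℝ) := ⟨Lip.toFun⟩

/-- Pointwise maximum `f ∨ h`. -/
instance (n : ℕ) : Max (Lip n) where
  max f h := ⟨fun x => max (f x) (h x), by
    obtain ⟨C, hC⟩ := f.lipschitz
    obtain ⟨D, hD⟩ := h.lipschitz
    exact ⟨max C D, hC.max hD⟩⟩

/-- Pointwise minimum `f ∧ h`. -/
instance (n : ℕ) : Min (Lip n) where
  min f h := ⟨fun x => min (f x) (h x), by
    obtain ⟨C, hC⟩ := f.lipschitz
    obtain ⟨D, hD⟩ := h.lipschitz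
    exact ⟨max C D, hC.min hD⟩⟩

/-- Pointwise sum. -/
instance (n : ℕ) : Add (Lip n) where
  add f h := ⟨fun x => f x + h x, by
    obtain ⟨C, hC⟩ := f.lipschitz
    obtain ⟨D, hD⟩ := h.lipschitz
    exact ⟨C + D, hC.add hD⟩⟩

/-- Pointwise multiplication by a real scalar. -/
instance (n : ℕ) : SMul ℝ (Lip n) where
  smul t f := ⟨fun x => t * f x, by
    obtain ⟨C, hC⟩ := f.lipschitz
    exact ⟨‖t‖₊ * C, LipschitzWith.of_dist_le_mul fun x y => by
      have h := hC.dist_le_mul x y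
      simp only [Real.dist_eq] at h ⊢
      rw [← mul_sub, abs_mul, NNReal.coe_mul, coe_nnnorm, Real.norm_eq_abs, mul_assoc]
      exact mul_le_mul_of_nonneg_left h (abs_nonneg t)⟩⟩

/-- The restriction to the sphere of a linear function `ℝⁿ → ℝ`. -/
def linearRestrict {n : ℕ} (l : E n →ₗ[ℝ] ℝ) : Lip n :=
  ⟨fun x => l x, ‖LinearMap.toContinuousLinearMap l‖₊, by
    have h := (LinearMap.toContinuousLinearMap l).lipschitz.comp
      (LipschitzWith.subtype_val (fun x : E n => x ∈ Metric.sphere (0 : E n) 1))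
    rw [mul_one] at h
    exact h⟩

/-! ### Spherical gradient and the topology on `Lip(S^{n-1})` -/

/-- `f : S^{n-1} → ℝ` is differentiable at `x`, with spherical gradient the tangent vector
`v ∈ x^⊥`: `f(y) = f(x) + ⟨v, y - x⟩ + o(|y - x|)` as `y → x` within the sphere. -/
def HasSphericalGradientAt {n : ℕ} (f : S n → ℝ) (v : E n) (x : S n) : Prop :=
  ⟪(x : E n), v⟫ = 0 ∧
    (fun y : S n => f y - f x - ⟪v, (y : E n) - (x : E n)⟫) =o[𝓝 x]
      (fun y : S n => (y : E n) - (x : E n))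

open Classical in
/-- The spherical gradient `∇f(x)` (the tangent vector is unique), with value `0` at points where `f` is not differentiable
(for Lipschitz `f` these form a null set). -/
def sphericalGradient {n : ℕ} (f : S n → ℝ) (x : S n) : E n :=
  if h : ∃ v, HasSphericalGradientAt f v x then h.choose else 0

/-- The `(n-1)`-dimensional Hausdorff measure on the sphere `S^{n-1}`, normalized so that it
is the usual surface measure. -/
def sphereMeasure (n : ℕ) : Measure (S n) := Measure.euclideanHausdorffMeasure (n - 1)

/-- `τ`-convergence of a sequence in `Lip(S^{n-1})`: uniform convergence, almost everywhere
convergence of the gradients, and a uniform `L^∞` bound on the gradients. -/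
structure TauConverges {n : ℕ} (f : ℕ → Lip n) (g : Lip n) : Prop where
  uniform : TendstoUniformly (fun j => (f j : S n → ℝ)) g atTop
  gradient : ∀ᵐ x ∂(sphereMeasure n),
    Tendsto (fun j => sphericalGradient (f j) x) atTop (𝓝 (sphericalGradient g x))
  bound : ∃ C : ℝ, 0 < C ∧ ∀ j, ∀ᵐ x ∂(sphereMeasure n), ‖sphericalGradient (f j) x‖ ≤ C

/-- The topology of `Lip(S^{n-1})`: its open sets are the `τ`-sequentially open sets. -/
instance (n : ℕ) : TopologicalSpace (Lip n) where
  IsOpen O := ∀ g ∈ O, ∀ f : ℕ → Lip n, TauConverges f g → ∃ N, ∀ j ≥ N, f j ∈ O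
  isOpen_univ := fun _ _ _ _ => ⟨0, fun _ _ => trivial⟩
  isOpen_inter := fun A B hA hB g hg f hf => by
    obtain ⟨N, hN⟩ := hA g hg.1 f hf
    obtain ⟨M, hM⟩ := hB g hg.2 f hf
    exact ⟨max N M, fun j hj => ⟨hN j (le_trans (le_max_left _ _) hj),
      hM j (le_trans (le_max_right _ _) hj)⟩⟩
  isOpen_sUnion := fun s hs g hg f hf => by
    obtain ⟨A, hA, hgA⟩ := hg
    obtain ⟨N, hN⟩ := hs A hA g hgA f hf
    exact ⟨N, fun j hj => ⟨A, hA, hN j hj⟩⟩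

/-! ### Valuations on `Lip(S^{n-1})` -/

/-- `Val(Lip(S^{n-1}))`: the continuous, dually translation invariant, complex-valued
valuations on `Lip(S^{n-1})`. -/
structure IsVal {n : ℕ} (ν : Lip n → ℂ) : Prop where
  continuous : Continuous ν
  valuation : ∀ f h : Lip n, ν (max f h) + ν (min f h) = ν f + ν h
  dually_translation_invariant :
    ∀ (f : Lip n) (l : E n →ₗ[ℝ] ℝ), ν (f + linearRestrict l) = ν f

/-- `Val_k(Lip(S^{n-1}))`: the `k`-homogeneous elements of `Val(Lip(S^{n-1}))`. -/
def Val (n k : ℕ) : Set (Lip n → ℂ) :=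
  {ν | IsVal ν ∧ ∀ (t : ℝ) (f : Lip n), 0 ≤ t → ν (t • f) = (t : ℂ) ^ k * ν f}

/-! ### Support function and surface area measure of a convex body -/

/-- The support function `h_K(y) = sup_{x ∈ K} ⟨y, x⟩` on `ℝⁿ`. -/
def supportFunction {n : ℕ} (K : ConvexBody (E n)) (y : E n) : ℝ :=
  sSup ((fun x : E n => ⟪y, x⟫) '' (K : Set (E n)))

theorem exists_lipschitzWith_supportFunction {n : ℕ} (K : ConvexBody (E n)) :
    ∃ C : ℝ≥0, LipschitzWith C (supportFunction K) := by
  obtain ⟨R, hR⟩ := K.isBounded.exists_norm_le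
  have bdd : ∀ y : E n, BddAbove ((fun x : E n => ⟪y, x⟫) '' (K : Set (E n))) := fun y =>
    (K.isCompact.image (by fun_prop)).bddAbove
  refine ⟨R.toNNReal, LipschitzWith.of_le_add_mul _ fun y z => ?_⟩
  refine csSup_le (K.nonempty.image _) ?_
  rintro _ ⟨x, hx, rfl⟩
  have h1 : ⟪z, x⟫ ≤ supportFunction K z := le_csSup (bdd z) ⟨x, hx, rfl⟩
  have h2 : ⟪y, x⟫ = ⟪z, x⟫ + ⟪y - z, x⟫ := by rw [inner_sub_left]; ring
  have h3 : ⟪y - z, x⟫ ≤ ‖y - z‖ * ‖x‖ := real_inner_le_norm _ _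
  have h4 : ‖y - z‖ * ‖x‖ ≤ ‖y - z‖ * R.toNNReal :=
    mul_le_mul_of_nonneg_left ((hR x hx).trans (Real.le_coe_toNNReal R)) (norm_nonneg _)
  change ⟪y, x⟫ ≤ _
  rw [dist_eq_norm]
  linarith

/-- The support function `h_K`, restricted to the unit sphere, as an element of
`Lip(S^{n-1})`. -/
def supportLip {n : ℕ} (K : ConvexBody (E n)) : Lip n :=
  ⟨fun x => supportFunction K x, by
    obtain ⟨C, hC⟩ := exists_lipschitzWith_supportFunction K
    refine ⟨C, ?_⟩
    have h := hC.comp (LipschitzWith.subtype_val (fun x : E n => x ∈ Metric.sphere (0 : E n) 1))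
    rw [mul_one] at h
    exact h⟩

/-- `u` is an outer unit normal vector of `K` at `x`: the half-space
`{y | ⟨y - x, u⟩ ≤ 0}` supports `K` at `x`. -/
def IsOuterNormal {n : ℕ} (K : ConvexBody (E n)) (x : E n) (u : S n) : Prop :=
  ∀ y ∈ K, ⟪y - x, (u : E n)⟫ ≤ 0

/-- The regular boundary points of `K`: those with a unique outer unit normal. -/
def regularBoundary {n : ℕ} (K : ConvexBody (E n)) : Set (E n) :=
  {x | x ∈ frontier (K : Set (E n)) ∧ ∃! u : S n, IsOuterNormal K x u}

/-- The Gauss map of `K`, which sends a regular boundary point to its outer unit normal. -/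
def gaussMap {n : ℕ} (K : ConvexBody (E n)) (x : regularBoundary K) : S n :=
  x.2.2.choose

theorem continuous_gaussMap {n : ℕ} (K : ConvexBody (E n)) : Continuous (gaussMap K) := by
  have key : {p : regularBoundary K × S n | gaussMap K p.1 = p.2} =
      ⋂ y ∈ K, {p : regularBoundary K × S n | ⟪y - (p.1 : E n), (p.2 : E n)⟫ ≤ 0} := by
    ext ⟨x, u⟩
    simp only [Set.mem_ofPred_eq, Set.mem_iInter]
    constructor
    · rintro rfl
      exact x.2.2.choose_spec.1
    · intro h
      exact (x.2.2.choose_spec.2 u h).symm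
  have closed : IsClosed {p : regularBoundary K × S n | gaussMap K p.1 = p.2} := by
    rw [key]
    exact isClosed_biInter fun y _ => isClosed_le (by fun_prop) continuous_const
  refine continuous_iff_isClosed.2 fun C hC => ?_
  have h : gaussMap K ⁻¹' C =
      Prod.fst '' ({p : regularBoundary K × S n | gaussMap K p.1 = p.2} ∩ Prod.snd ⁻¹' C) := by
    ext x
    constructor
    · intro hx
      exact ⟨(x, gaussMap K x), ⟨rfl, hx⟩, rfl⟩
    · rintro ⟨⟨y, u⟩, ⟨hyu, hu⟩, rfl⟩
      change gaussMap K y = u at hyu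
      change gaussMap K y ∈ C
      rw [hyu]
      exact hu
  rw [h]
  exact isClosedMap_fst_of_compactSpace _ (closed.inter (hC.preimage continuous_snd))

open Classical in
/-- The surface area measure `S_{n-1}(K, ·)` of a convex body `K`, a Borel measure on the sphere.
If `K` is contained in a hyperplane with unit normal `u`, it is `H^{n-1}(K) (δ_u + δ_{-u})`
(which does not depend on `u`, and is zero if `dim K ≤ n - 2`). Otherwise `K` has interior points
and `S_{n-1}(K, ω) = H^{n-1}(N⁻¹(ω))` for the Gauss map `N` of `K`. -/
def surfaceAreaMeasure {n : ℕ} (K : ConvexBody (E n)) : Measure (S n) :=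
  if h : ∃ u : S n, ∀ x ∈ K, ∀ y ∈ K, ⟪y - x, (u : E n)⟫ = 0 then
    (Measure.euclideanHausdorffMeasure (n - 1) (K : Set (E n))) •
      (Measure.dirac h.choose + Measure.dirac (-h.choose))
  else
    Measure.map (gaussMap K)
      (Measure.euclideanHausdorffMeasure (n - 1) : Measure (regularBoundary K))

/-- The functional `μ_{n-1}(K) = ∫ x₁³ dS_{n-1}(K, x)`; the first coordinate has index `0`. -/
def muOdd {n : ℕ} (hn : 0 < n) (K : ConvexBody (E n)) : ℝ :=
  ∫ x : S n, ((x : E n) ⟨0, hn⟩) ^ 3 ∂(surfaceAreaMeasure K)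

end LipVal

end

noncomputable section

namespace LipVal

/-! ### Lattice valuations -/

/-! Suppose such a `ν` exists. The support function of the simplex with vertices `0, a₁, …, aₙ` is
`0 ∨ maxᵢ ⟨aᵢ, ·⟩`. Omitting some of the `aᵢ` leaves a body in a hyperplane, whose surface area
measure is even and hence invisible to the odd integrand. Inclusion–exclusion therefore forces `ν (0
∨ minᵢ ⟨aᵢ, ·⟩)` to be, up to sign, the functional of the full simplex (`valuation_coneLip`),
although this function, positive only inside a simplicial cone, need not be a support function.
Functions on disjoint cones add up under `ν` (`valuation_sup'_of_disjoint`).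

Take `N` disjoint cones of width of order `1/N`. The maximum of their functions is uniformly
Lipschitz, at most `1/N`, and at each fixed point zero for large `N`; so it τ-converges to `0`
(`tauConverges_bumps`). Yet in each simplex only two facets have normals with nonzero first
coordinate: one of area at least `c/N` with normal `-e₀`, and one of bounded area whose normal has
first coordinate at most `1/N`. The functional is thus at most `C/N³ - c/N` (`exists_muOdd_le`), and
the sum over the cones at most `C/N² - c`, which cannot tend to `ν 0 = 0`. The third power matters:
for the integrand `x₁` the two contributions cancel.

Four coordinates are used: index `0` for the integrand, `1` and `2` for the slope that separates the
cones, and `3` to make them leave every fixed point. -/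

theorem valuation_sup_inf' {L ι : Type*} [DistribLattice L] {ν : L → ℂ}
    (hν : ∀ f h, ν (f ⊔ h) + ν (f ⊓ h) = ν f + ν h) (g : ι → L) (s : Finset ι) (hs : s.Nonempty) :
    ∀ h, (∀ (J : Finset ι) (hJ : J.Nonempty), J ⊂ s → ν (h ⊔ J.sup' hJ g) = 0) →
      ν (h ⊔ s.inf' hs g) = (-1) ^ (s.card + 1) * ν (h ⊔ s.sup' hs g) := by
  induction hs using Finset.Nonempty.cons_induction with
  | singleton a => intro h _; simp
  | cons a s ha hs ih =>
    intro h H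
    have h1 : ν (h ⊔ g a) = 0 := by
      have := H {a} (Finset.singleton_nonempty a) (by
        refine Finset.ssubset_iff_subset_ne.2 ⟨by simp, fun h => ?_⟩
        obtain ⟨b, hb⟩ := hs
        have : b ∈ ({a} : Finset ι) := by rw [h]; simp [hb]
        rw [Finset.mem_singleton] at this
        exact ha (this ▸ hb))
      simpa using this
    have hss : s ⊂ Finset.cons a s ha := Finset.ssubset_cons ha
    have h2 : ν (h ⊔ s.inf' hs g) = 0 := by
      rw [ih h fun J hJ hJs => H J hJ (hJs.trans hss), H s hs hss, mul_zero]
    -- The claim is stated for all `h` so that the induction hypothesis applies both to `h` and to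
    -- `h ⊔ g a`.
    have h3 := ih (h ⊔ g a) fun J hJ hJs => by
      have haJ : a ∉ J := fun h => ha (hJs.1 h)
      have := H (Finset.cons a J haJ) (Finset.cons_nonempty haJ) (by
        refine Finset.ssubset_iff_subset_ne.2 ⟨Finset.cons_subset_cons.2 hJs.1, fun h => hJs.ne ?_⟩
        exact Finset.Subset.antisymm hJs.1 fun i hi => (Finset.mem_cons.1
          (h ▸ Finset.mem_cons_of_mem hi : i ∈ Finset.cons a J haJ)).resolve_left
            (fun hia => ha (hia ▸ hi)))
      rwa [Finset.sup'_cons hJ, ← sup_assoc] at this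
    -- By distributivity the meet of these two is `h ⊔ (g a ⊓ inf s)`. Both have value zero, so only
    -- the join survives, with a change of sign.
    have h4 := hν (h ⊔ g a) (h ⊔ s.inf' hs g)
    rw [← sup_inf_left, h1, h2, sup_sup_sup_comm, sup_idem, ← sup_assoc, h3] at h4
    rw [Finset.inf'_cons hs, Finset.sup'_cons hs, Finset.card_cons, ← sup_assoc]
    linear_combination h4

theorem valuation_sup'_of_disjoint {L ι : Type*} [DistribLattice L] {ν : L → ℂ}
    (hν : ∀ f h, ν (f ⊔ h) + ν (f ⊓ h) = ν f + ν h) (z : L) (hz : ν z = 0) (g : ι → L)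
    (s : Finset ι) (hs : s.Nonempty) (hg : ∀ i ∈ s, ∀ j ∈ s, i ≠ j → g i ⊓ g j = z) :
    ν (s.sup' hs g) = ∑ i ∈ s, ν (g i) := by
  induction hs using Finset.Nonempty.cons_induction with
  | singleton a => simp
  | cons a s ha hs ih =>
    have h1 : g a ⊓ s.sup' hs g = z := by
      rw [Finset.sup'_inf_distrib_left]
      refine (Finset.sup'_congr hs rfl fun i hi => hg a (by simp) i (by simp [hi]) ?_).trans
        (Finset.sup'_const hs z)
      rintro rfl; exact ha hi
    have h2 := hν (g a) (s.sup' hs g)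
    rw [h1, hz, add_zero, ih fun i hi j hj => hg i (by simp [hi]) j (by simp [hj])] at h2
    rw [Finset.sup'_cons hs, h2, Finset.sum_cons]

/-! ### The lattice of Lipschitz functions -/

theorem Lip.toFun_injective {n : ℕ} : Function.Injective (Lip.toFun (n := n)) :=
  fun _ _ h => Lip.ext h

instance (n : ℕ) : LE (Lip n) := ⟨fun f g => f.toFun ≤ g.toFun⟩
instance (n : ℕ) : LT (Lip n) := ⟨fun f g => f.toFun < g.toFun⟩

/-- Pulled back along `toFun`, so that `⊔` and `⊓` are definitionally the `max` and `min` of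
`IsVal`. -/
instance (n : ℕ) : DistribLattice (Lip n) :=
  Lip.toFun_injective.distribLattice _ Iff.rfl Iff.rfl (fun _ _ => rfl) (fun _ _ => rfl)

instance (n : ℕ) : Zero (Lip n) := ⟨linearRestrict 0⟩

@[simp] theorem Lip.zero_apply {n : ℕ} (x : S n) : (0 : Lip n) x = 0 := rfl

@[simp] theorem Lip.sup_apply {n : ℕ} (f g : Lip n) (x : S n) : (f ⊔ g) x = f x ⊔ g x := rfl

@[simp] theorem Lip.inf_apply {n : ℕ} (f g : Lip n) (x : S n) : (f ⊓ g) x = f x ⊓ g x := rfl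

theorem Lip.sup'_apply {n : ℕ} {ι : Type*} (s : Finset ι) (hs : s.Nonempty) (g : ι → Lip n)
    (x : S n) : (s.sup' hs g) x = s.sup' hs fun i => g i x :=
  Finset.apply_sup'_eq_sup'_comp hs (fun f : Lip n => f x) fun _ _ => rfl

theorem Lip.inf'_apply {n : ℕ} {ι : Type*} (s : Finset ι) (hs : s.Nonempty) (g : ι → Lip n)
    (x : S n) : (s.inf' hs g) x = s.inf' hs fun i => g i x :=
  Finset.apply_inf'_eq_inf'_comp hs (fun f : Lip n => f x) fun _ _ => rfl

theorem Lip.lipschitzWith_sup' {n : ℕ} {ι : Type*} {C : ℝ≥0} (s : Finset ι) (hs : s.Nonempty)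
    (g : ι → Lip n) (h : ∀ i ∈ s, LipschitzWith C (g i)) : LipschitzWith C (s.sup' hs g : Lip n) :=
  Finset.sup'_induction hs g (p := fun f : Lip n => LipschitzWith C f)
    (fun _ hf _ hk => (max_self C) ▸ hf.max hk) h

theorem Lip.lipschitzWith_inf' {n : ℕ} {ι : Type*} {C : ℝ≥0} (s : Finset ι) (hs : s.Nonempty)
    (g : ι → Lip n) (h : ∀ i ∈ s, LipschitzWith C (g i)) : LipschitzWith C (s.inf' hs g : Lip n) :=
  Finset.inf'_induction hs g (p := fun f : Lip n => LipschitzWith C f)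
    (fun _ hf _ hk => (max_self C) ▸ hf.min hk) h

/-! ### Spherical gradients -/

/-- Normalise `x + s • v`: as `v ⊥ x`, its norm `√(1 + s²‖v‖²)` is stationary at `s = 0`. Gradients
are tested along such curves instead of in charts. -/
theorem exists_curve {n : ℕ} (x : S n) (v : E n) (hv : ⟪(x : E n), v⟫ = 0) :
    ∃ γ : ℝ → S n, γ 0 = x ∧ HasDerivAt (fun s => (γ s : E n)) v 0 := by
  have hx : ‖(x : E n)‖ = 1 := by simp
  have hn : ∀ s : ℝ, ‖(x : E n) + s • v‖ ^ 2 = 1 + s ^ 2 * ‖v‖ ^ 2 := fun s => by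
    rw [norm_add_sq_real, inner_smul_right, hv, norm_smul, hx, mul_pow, Real.norm_eq_abs, sq_abs]
    ring
  have hn' : ∀ s : ℝ, ‖(x : E n) + s • v‖ = √(1 + s ^ 2 * ‖v‖ ^ 2) := fun s => by
    rw [← hn, Real.sqrt_sq (norm_nonneg _)]
  have h0 : ∀ s : ℝ, ‖(x : E n) + s • v‖ ≠ 0 := fun s h => by
    have := hn s
    rw [h] at this
    nlinarith [mul_nonneg (sq_nonneg s) (sq_nonneg ‖v‖)]
  refine ⟨fun s => ⟨‖(x : E n) + s • v‖⁻¹ • ((x : E n) + s • v), by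
    rw [mem_sphere_zero_iff_norm, norm_smul, norm_inv, norm_norm, inv_mul_cancel₀ (h0 s)]⟩, ?_, ?_⟩
  · ext1; simp
  · simp only [hn']
    have h1 : HasDerivAt (fun s : ℝ => (√(1 + s ^ 2 * ‖v‖ ^ 2))⁻¹) 0 0 := by
      have h2 : HasDerivAt (fun s : ℝ => 1 + s ^ 2 * ‖v‖ ^ 2) 0 0 := by
        have := (((hasDerivAt_id (0 : ℝ)).pow 2).mul_const (‖v‖ ^ 2)).const_add 1
        simpa using this
      have := (h2.sqrt (by simp)).inv (by simp)
      simp only [zero_div, neg_zero] at this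
      exact this
    have h2 : HasDerivAt (fun s : ℝ => (x : E n) + s • v) v 0 := by
      have := ((hasDerivAt_id (0 : ℝ)).smul_const v).const_add (x : E n)
      simpa using this
    have := h1.smul h2
    simp only [zero_smul, add_zero, ne_eq, OfNat.ofNat_ne_zero, not_false_eq_true, zero_pow,
      zero_mul, Real.sqrt_one, inv_one, one_smul] at this
    exact this

theorem HasSphericalGradientAt.hasDerivAt_comp {n : ℕ} {f : S n → ℝ} {v : E n} {x : S n}
    (h : HasSphericalGradientAt f v x) {γ : ℝ → S n} {u : E n} (h0 : γ 0 = x)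
    (hγ : HasDerivAt (fun s => (γ s : E n)) u 0) : HasDerivAt (fun s => f (γ s)) ⟪v, u⟫ 0 := by
  subst h0
  have hc : Tendsto γ (𝓝 0) (𝓝 (γ 0)) := by
    rw [tendsto_subtype_rng]; exact hγ.continuousAt
  have h1 := h.2.comp_tendsto hc
  have h2 : (fun s => (γ s : E n) - (γ 0 : E n)) =O[𝓝 0] (fun s : ℝ => s - 0) := hγ.isBigO_sub
  have h3 := h1.trans_isBigO h2
  have h4 : HasDerivAt (fun s => ⟪v, (γ s : E n)⟫) ⟪v, u⟫ 0 := by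
    simpa using (hasDerivAt_const (0 : ℝ) v).inner ℝ hγ
  rw [hasDerivAt_iff_isLittleO] at h4 ⊢
  refine (h3.add h4).congr_left fun s => ?_
  simp [inner_sub_right]

/-- Along a curve with velocity `v`, the function has a minimum at `0` and derivative `⟪v, v⟫`
there. -/
theorem HasSphericalGradientAt.eq_zero {n : ℕ} {f : S n → ℝ} {v : E n} {x : S n}
    (h : HasSphericalGradientAt f v x) (hf : ∀ y, 0 ≤ f y) (hx : f x = 0) : v = 0 := by
  obtain ⟨γ, h0, hγ⟩ := exists_curve x v h.1
  have h1 := h.hasDerivAt_comp h0 hγ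
  have h2 : IsLocalMin (fun s => f (γ s)) 0 := Eventually.of_forall fun s => by
    simp only [h0, hx]; exact hf _
  exact inner_self_eq_zero.1 (h2.hasDerivAt_eq_zero h1)

theorem HasSphericalGradientAt.norm_le {n : ℕ} {f : S n → ℝ} {v : E n} {x : S n} {C : ℝ≥0}
    (h : HasSphericalGradientAt f v x) (hf : LipschitzWith C f) : ‖v‖ ≤ C := by
  obtain ⟨γ, h0, hγ⟩ := exists_curve x v h.1
  have h1 := (h.hasDerivAt_comp h0 hγ).tendsto_slope.norm
  have h2 := (hγ.tendsto_slope.norm).const_mul (C : ℝ)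
  have h3 : ‖⟪v, v⟫‖ ≤ C * ‖v‖ := le_of_tendsto_of_tendsto' h1 h2 fun s => by
    rw [slope_def_module, slope_def_module, norm_smul, norm_smul, mul_left_comm]
    refine mul_le_mul_of_nonneg_left ?_ (norm_nonneg _)
    have := hf.dist_le_mul (γ s) (γ 0)
    rwa [Subtype.dist_eq, dist_eq_norm, dist_eq_norm] at this
  rw [Real.norm_of_nonneg real_inner_self_nonneg, real_inner_self_eq_norm_sq] at h3
  rcases (norm_nonneg v).eq_or_lt with h4 | h4
  · rw [← h4]; positivity
  · nlinarith

/-- No differentiability is needed, since the default value of the gradient is also `0`. -/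
theorem sphericalGradient_eq_zero {n : ℕ} {f : S n → ℝ} {x : S n} (hf : ∀ y, 0 ≤ f y)
    (hx : f x = 0) : sphericalGradient f x = 0 := by
  unfold sphericalGradient
  split_ifs with h
  · exact h.choose_spec.eq_zero hf hx
  · rfl

theorem norm_sphericalGradient_le {n : ℕ} {f : S n → ℝ} {C : ℝ≥0} (hf : LipschitzWith C f)
    (x : S n) : ‖sphericalGradient f x‖ ≤ C := by
  unfold sphericalGradient
  split_ifs with h
  · exact h.choose_spec.norm_le hf
  · simp

/-- A zero of a nonnegative function is a minimum, so the gradients vanish eventually at every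
point, with no exceptional null set. -/
theorem tauConverges_zero {n : ℕ} {f : ℕ → Lip n} {C : ℝ≥0} (hL : ∀ j, LipschitzWith C (f j))
    (h0 : ∀ j x, 0 ≤ f j x) (hu : TendstoUniformly (fun j => (f j : S n → ℝ)) (0 : Lip n) atTop)
    (he : ∀ x, ∀ᶠ j in atTop, f j x = 0) : TauConverges f 0 where
  uniform := hu
  gradient := ae_of_all _ fun x => by
    rw [sphericalGradient_eq_zero (f := (0 : Lip n)) (fun _ => le_rfl) rfl]
    exact tendsto_const_nhds.congr' ((he x).mono fun j hj =>
      (sphericalGradient_eq_zero (h0 j) hj).symm)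
  bound := ⟨C + 1, by positivity, fun j => ae_of_all _ fun x =>
    (norm_sphericalGradient_le (hL j) x).trans (by simp)⟩

theorem TauConverges.tendsto {n : ℕ} {f : ℕ → Lip n} {g : Lip n} (h : TauConverges f g)
    {X : Type*} [TopologicalSpace X] {ν : Lip n → X} (hν : Continuous ν) :
    Tendsto (fun j => ν (f j)) atTop (𝓝 (ν g)) := by
  rw [tendsto_atTop_nhds]
  intro U hg hU
  exact hU.preimage hν g hg f h

/-! ### Convex hulls of finitely many points and the origin -/

/-- The convex hull of the origin and of the points `a i`, `i ∈ J`. -/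
def hullBody {n : ℕ} {ι : Type*} (a : ι → E n) (J : Finset ι) : ConvexBody (E n) where
  carrier := convexHull ℝ (insert 0 (a '' J))
  convex' := convex_convexHull ℝ _
  isCompact' := ((J.finite_toSet.image a).insert 0).isCompact_convexHull ℝ
  nonempty' := ⟨0, subset_convexHull ℝ _ (Set.mem_insert _ _)⟩

theorem mem_hullBody {n : ℕ} {ι : Type*} {a : ι → E n} {J : Finset ι} {x : E n} :
    x ∈ hullBody a J ↔ x ∈ convexHull ℝ (insert 0 (a '' J)) := Iff.rfl

/-- The linear function `⟨a, ·⟩` on the sphere. -/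
def linearLip {n : ℕ} (a : E n) : Lip n := linearRestrict (innerₛₗ ℝ a)

@[simp] theorem linearLip_apply {n : ℕ} (a : E n) (x : S n) : linearLip a x = ⟪a, (x : E n)⟫ := rfl

theorem supportFunction_hullBody {n : ℕ} {ι : Type*} (a : ι → E n) (J : Finset ι)
    (hJ : J.Nonempty) (y : E n) :
    supportFunction (hullBody a J) y = 0 ⊔ J.sup' hJ fun i => ⟪a i, y⟫ := by
  have hb : BddAbove ((fun x : E n => ⟪y, x⟫) '' (hullBody a J : Set (E n))) :=
    ((hullBody a J).isCompact.image (by fun_prop)).bddAbove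
  apply le_antisymm
  · refine csSup_le ((hullBody a J).nonempty.image _) ?_
    rintro _ ⟨x, hx, rfl⟩
    refine convexHull_min (t := {x : E n | ⟪y, x⟫ ≤ 0 ⊔ J.sup' hJ fun i => ⟪a i, y⟫}) ?_
      (convex_halfSpace_le (innerₛₗ ℝ y).isLinear _) hx
    rintro _ (rfl | ⟨i, hi, rfl⟩)
    · simp
    · simp only [Set.mem_ofPred_eq]
      rw [real_inner_comm]
      exact le_sup_of_le_right (Finset.le_sup' (fun i => ⟪a i, y⟫) hi)
  · refine sup_le ?_ (Finset.sup'_le _ _ fun i hi => ?_)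
    · exact le_csSup hb ⟨0, subset_convexHull ℝ _ (Set.mem_insert _ _), by simp⟩
    · exact le_csSup hb ⟨a i, subset_convexHull ℝ _ (Set.mem_insert_of_mem _ ⟨i, hi, rfl⟩),
        real_inner_comm _ _⟩

theorem supportLip_hullBody {n : ℕ} {ι : Type*} (a : ι → E n) (J : Finset ι) (hJ : J.Nonempty) :
    supportLip (hullBody a J) = 0 ⊔ J.sup' hJ fun i => linearLip (a i) := by
  ext x
  rw [Lip.sup_apply, Lip.sup'_apply]
  exact supportFunction_hullBody a J hJ x

theorem supportLip_hullBody_empty {n : ℕ} {ι : Type*} (a : ι → E n) :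
    supportLip (hullBody a ∅) = 0 := by
  ext x
  change sSup _ = (0 : ℝ)
  have : (hullBody a ∅ : Set (E n)) = {0} := by
    change convexHull ℝ (insert 0 (a '' (∅ : Finset ι))) = {0}
    simp
  rw [this]; simp

theorem hullBody_eq_simplex {n : ℕ} {a b : Fin n → E n}
    (hab : ∀ i j, ⟪b i, a j⟫ = if i = j then 1 else 0) (hsum : ∀ x, x = ∑ i, ⟪b i, x⟫ • a i)
    {x : E n} : x ∈ hullBody a Finset.univ ↔ (∀ i, 0 ≤ ⟪b i, x⟫) ∧ ⟪∑ i, b i, x⟫ ≤ 1 := by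
  rw [mem_hullBody]
  constructor
  · intro hx
    have hc : Convex ℝ {x : E n | (∀ i, 0 ≤ ⟪b i, x⟫) ∧ ⟪∑ i, b i, x⟫ ≤ 1} := by
      rw [Set.ofPred_and, Set.ofPred_forall]
      exact (convex_iInter fun i => convex_halfSpace_ge (innerₛₗ ℝ (b i)).isLinear 0).inter
        (convex_halfSpace_le (innerₛₗ ℝ (∑ i, b i)).isLinear 1)
    refine convexHull_min ?_ hc hx
    rintro _ (rfl | ⟨j, -, rfl⟩)
    · simp
    · refine ⟨fun i => ?_, ?_⟩
      · rw [hab]; split_ifs <;> simp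
      · simp [sum_inner, hab]
  · rintro ⟨h0, h1⟩
    rw [sum_inner] at h1
    -- The coordinates `⟪b i, x⟫` are the barycentric weights; `none` stands for the origin, which
    -- takes the remaining weight.
    have := (convex_convexHull ℝ (insert 0 (a '' (Finset.univ : Finset (Fin n))))).sum_mem
      (t := Finset.univ) (w := fun o : Option (Fin n) => o.elim (1 - ∑ i, ⟪b i, x⟫) fun i => ⟪b i, x⟫)
      (z := fun o => o.elim 0 a) (fun o _ => by cases o <;> simp [h0, h1])
      (by simp [Fintype.sum_option]) (fun o _ => by
        cases o
        · exact subset_convexHull ℝ _ (Set.mem_insert _ _)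
        · exact subset_convexHull ℝ _ (Set.mem_insert_of_mem _ ⟨_, by simp, rfl⟩))
    rw [Fintype.sum_option] at this
    simpa [← hsum x] using this

/-- Surface area measures of lower-dimensional bodies are even. -/
theorem muOdd_eq_zero {n : ℕ} (hn : 0 < n) (K : ConvexBody (E n)) (u : S n)
    (hu : ∀ x ∈ K, ∀ y ∈ K, ⟪y - x, (u : E n)⟫ = 0) : muOdd hn K = 0 := by
  have h : ∃ u : S n, ∀ x ∈ K, ∀ y ∈ K, ⟪y - x, (u : E n)⟫ = 0 := ⟨u, hu⟩
  rw [muOdd, surfaceAreaMeasure, dif_pos h, integral_smul_measure,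
    integral_add_measure (integrable_dirac (by simp [enorm_lt_top]))
      (integrable_dirac (by simp [enorm_lt_top])), integral_dirac, integral_dirac]
  have : ((-h.choose : S n) : E n) ⟨0, hn⟩ = - (h.choose : E n) ⟨0, hn⟩ := rfl
  rw [this]
  simp [Odd.neg_pow (show Odd 3 by decide)]

/-- Fewer than `n` vectors span a proper subspace, so the hull lies in a hyperplane through the
origin. This kills the lower terms of the inclusion–exclusion. -/
theorem muOdd_hullBody_eq_zero {n : ℕ} (hn : 0 < n) {a : Fin n → E n} {J : Finset (Fin n)}
    (hJ : J ⊂ Finset.univ) : muOdd hn (hullBody a J) = 0 := by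
  set V : Submodule ℝ (E n) := Submodule.span ℝ (a '' J) with hV
  have hlt : Module.finrank ℝ V < n := by
    have h1 : Module.finrank ℝ V ≤ J.card := by
      classical
      have := finrank_span_finset_le_card (R := ℝ) (J.image a)
      rw [Set.finrank, Finset.coe_image] at this
      exact this.trans Finset.card_image_le
    have h2 := Finset.card_lt_card hJ
    rw [Finset.card_univ, Fintype.card_fin] at h2
    omega
  have hbot : Vᗮ ≠ ⊥ := fun h => by
    rw [Submodule.orthogonal_eq_bot_iff] at h
    rw [h, finrank_top, finrank_euclideanSpace_fin] at hlt
    exact hlt.ne rfl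
  obtain ⟨v, hv, hv0⟩ := Submodule.exists_mem_ne_zero_of_ne_bot hbot
  have hV' : ∀ x ∈ hullBody a J, x ∈ V := fun x hx => by
    refine convexHull_min ?_ V.convex hx
    rintro _ (rfl | h)
    · exact V.zero_mem
    · exact Submodule.subset_span h
  refine muOdd_eq_zero hn _ ⟨‖v‖⁻¹ • v, by
    rw [mem_sphere_zero_iff_norm, norm_smul, norm_inv, norm_norm,
      inv_mul_cancel₀ (norm_ne_zero_iff.2 hv0)]⟩ fun x hx y hy => ?_
  exact (Submodule.mem_orthogonal _ _).1 (Submodule.smul_mem _ _ hv) _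
    (V.sub_mem (hV' y hy) (hV' x hx))

/-- The restriction to the sphere of `max(0, minᵢ ⟨aᵢ, ·⟩)`. -/
def coneLip {n : ℕ} [NeZero n] (a : Fin n → E n) : Lip n :=
  0 ⊔ Finset.univ.inf' Finset.univ_nonempty fun i => linearLip (a i)

theorem coneLip_nonneg {n : ℕ} [NeZero n] (a : Fin n → E n) (x : S n) : 0 ≤ coneLip a x := by
  rw [coneLip, Lip.sup_apply]; exact le_sup_left

theorem coneLip_le {n : ℕ} [NeZero n] (a : Fin n → E n) (x : S n) (i : Fin n) :
    coneLip a x ≤ max 0 ⟪a i, (x : E n)⟫ := by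
  rw [coneLip, Lip.sup_apply, Lip.inf'_apply]
  exact max_le_max le_rfl (Finset.inf'_le (fun i => linearLip (a i) x) (Finset.mem_univ i))

theorem inner_pos_of_coneLip_pos {n : ℕ} [NeZero n] {a : Fin n → E n} {x : S n}
    (h : 0 < coneLip a x) (i : Fin n) : 0 < ⟪a i, (x : E n)⟫ :=
  (lt_max_iff.1 (h.trans_le (coneLip_le a x i))).resolve_left (lt_irrefl _)

theorem lipschitzWith_linearLip {n : ℕ} (a : E n) : LipschitzWith ‖a‖₊ (linearLip a) := by
  refine LipschitzWith.of_dist_le_mul fun x y => ?_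
  rw [Real.dist_eq, linearLip_apply, linearLip_apply, ← inner_sub_right, Subtype.dist_eq,
    dist_eq_norm]
  exact abs_real_inner_le_norm _ _

theorem lipschitzWith_coneLip {n : ℕ} [NeZero n] {a : Fin n → E n} {C : ℝ≥0}
    (h : ∀ i, ‖a i‖₊ ≤ C) : LipschitzWith C (coneLip a) := by
  have h1 := Lip.lipschitzWith_inf' Finset.univ Finset.univ_nonempty (fun i => linearLip (a i))
    (C := C) fun i _ => (lipschitzWith_linearLip (a i)).weaken (h i)
  have h2 : LipschitzWith C (0 : Lip n) := (LipschitzWith.const (0 : ℝ)).weaken (by simp)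
  exact (max_self C) ▸ h2.max h1

/-- Inclusion–exclusion with `h = 0`: every join that occurs is a support function, and only the one
of the full simplex has a possibly nonzero value. -/
theorem valuation_coneLip {n : ℕ} [NeZero n] (hn : 0 < n) {ν : Lip n → ℂ} (hν : IsVal ν)
    (h : ∀ K : ConvexBody (E n), ν (supportLip K) = (muOdd hn K : ℂ)) (a : Fin n → E n) :
    ν (coneLip a) = (-1) ^ (n + 1) * (muOdd hn (hullBody a Finset.univ) : ℂ) := by
  rw [coneLip, valuation_sup_inf' hν.valuation, ← supportLip_hullBody, h, Finset.card_univ,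
    Fintype.card_fin]
  intro J hJ hJs
  rw [← supportLip_hullBody, h, muOdd_hullBody_eq_zero hn hJs, Complex.ofReal_zero]

/-! ### Hausdorff measure of pieces of hyperplanes -/

/-- Bounded pieces of hyperplanes have uniformly bounded area. -/
theorem exists_hausdorffMeasure_hyperplane_le (m : ℕ) (R : ℝ) :
    ∃ C : ℝ≥0, ∀ (w : E (m + 1)) (c : ℝ), w ≠ 0 →
      Measure.euclideanHausdorffMeasure m {x : E (m + 1) | ⟪w, x⟫ = c ∧ ‖x‖ ≤ R} ≤ C := by
  -- Seen from one of its own points, the piece lies in a ball of radius `2 * R` of an isometric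
  -- copy of `ℝᵐ`, whatever `w` and `c` are.
  refine ⟨(volume (Metric.closedBall (0 : E m) (2 * R))).toNNReal, fun w c hw => ?_⟩
  rw [ENNReal.coe_toNNReal measure_closedBall_lt_top.ne]
  rcases Set.eq_empty_or_nonempty {x : E (m + 1) | ⟪w, x⟫ = c ∧ ‖x‖ ≤ R} with h | ⟨x₀, hx₀, hx₀R⟩
  · rw [h]; simp
  have : Fact (Module.finrank ℝ (E (m + 1)) = m + 1) := ⟨finrank_euclideanSpace_fin⟩
  set e := (OrthonormalBasis.fromOrthogonalSpanSingleton (𝕜 := ℝ) m hw).repr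
  have hiso : Isometry fun z : E m => x₀ + ((e.symm z : _) : E (m + 1)) :=
    (IsometryEquiv.addLeft x₀).isometry.comp (isometry_subtype_coe.comp e.symm.isometry)
  rw [← EuclideanSpace.euclideanHausdorffMeasure_eq_volume, ← hiso.euclideanHausdorffMeasure_image]
  refine measure_mono fun x hx => ?_
  have hmem : x - x₀ ∈ (Submodule.span ℝ {w})ᗮ := by
    rw [Submodule.mem_orthogonal_singleton_iff_inner_right, inner_sub_right, hx.1, hx₀, sub_self]
  refine ⟨e ⟨x - x₀, hmem⟩, ?_, ?_⟩
  · rw [mem_closedBall_zero_iff, LinearIsometryEquiv.norm_map]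
    change ‖x - x₀‖ ≤ _
    linarith [norm_sub_le x x₀, hx.2]
  · simp

/-! ### Surface area measure of a simplex -/

section simplex

variable {n : ℕ} {a b : Fin n → E n}

theorem eq_zero_of_inner_eq_zero (hsum : ∀ x, x = ∑ i, ⟪b i, x⟫ • a i) {v : E n}
    (h : ∀ i, ⟪a i, v⟫ = 0) : v = 0 := by
  have : ⟪v, v⟫ = 0 := by
    conv_lhs => enter [2]; rw [hsum v]
    rw [sum_inner]
    exact Finset.sum_eq_zero fun i _ => by rw [real_inner_smul_left, h, mul_zero]
  exact inner_self_eq_zero.1 this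

theorem norm_le_of_mem_hullBody {ι : Type*} {a : ι → E n} {J : Finset ι} {R : ℝ} (hR : 0 ≤ R)
    (ha : ∀ i, ‖a i‖ ≤ R) {x : E n} (hx : x ∈ hullBody a J) : ‖x‖ ≤ R := by
  rw [← mem_closedBall_zero_iff]
  refine convexHull_min ?_ (convex_closedBall 0 R) hx
  rintro _ (rfl | ⟨i, -, rfl⟩)
  · simpa using hR
  · simpa using ha i

theorem gaussMap_eq {K : ConvexBody (E n)} (x : regularBoundary K) (u : S n)
    (hu : IsOuterNormal K x u) : gaussMap K x = u :=
  (x.2.2.choose_spec.2 u hu).symm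

theorem muOdd_eq_integral_gaussMap (hn : 0 < n) {K : ConvexBody (E n)}
    (h : ¬ ∃ u : S n, ∀ x ∈ K, ∀ y ∈ K, ⟪y - x, (u : E n)⟫ = 0) :
    muOdd hn K = ∫ x : regularBoundary K, (gaussMap K x : E n) ⟨0, hn⟩ ^ 3
      ∂(Measure.euclideanHausdorffMeasure (n - 1)) := by
  rw [muOdd, surfaceAreaMeasure, dif_neg h,
    integral_map (continuous_gaussMap K).measurable.aemeasurable]
  exact Continuous.aestronglyMeasurable (by fun_prop)

/-- The unit vector in the direction of a nonzero vector. -/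
def direction (v : E n) (hv : v ≠ 0) : S n :=
  ⟨‖v‖⁻¹ • v, by
    rw [mem_sphere_zero_iff_norm, norm_smul, norm_inv, norm_norm,
      inv_mul_cancel₀ (norm_ne_zero_iff.2 hv)]⟩

theorem isOuterNormal_direction {K : ConvexBody (E n)} {v : E n} (hv : v ≠ 0) {x : E n}
    (h : ∀ y ∈ K, ⟪v, y⟫ ≤ ⟪v, x⟫) : IsOuterNormal K x (direction v hv) := fun y hy => by
  change ⟪y - x, ‖v‖⁻¹ • v⟫ ≤ 0
  rw [inner_smul_right, real_inner_comm, inner_sub_right]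
  exact mul_nonpos_of_nonneg_of_nonpos (by positivity) (sub_nonpos.2 (h y hy))

theorem dual_ne_zero (hab : ∀ i j, ⟪b i, a j⟫ = if i = j then 1 else 0)
    (i : Fin n) : b i ≠ 0 := fun h => by
  have := hab i i
  simp [h] at this

theorem hullBody_nondegenerate (hsum : ∀ x, x = ∑ i, ⟪b i, x⟫ • a i) :
    ¬ ∃ u : S n, ∀ x ∈ hullBody a Finset.univ, ∀ y ∈ hullBody a Finset.univ,
      ⟪y - x, (u : E n)⟫ = 0 := by
  rintro ⟨u, hu⟩
  have h0 : (u : E n) = 0 := eq_zero_of_inner_eq_zero hsum fun i => by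
    have := hu 0 (subset_convexHull ℝ _ (Set.mem_insert _ _)) (a i)
      (subset_convexHull ℝ _ (Set.mem_insert_of_mem _ ⟨i, by simp, rfl⟩))
    rwa [sub_zero] at this
  have h1 : ‖(u : E n)‖ = 1 := by simp
  rw [h0, norm_zero] at h1
  exact zero_ne_one h1

theorem mem_face_of_mem_frontier (hab : ∀ i j, ⟪b i, a j⟫ = if i = j then 1 else 0)
    (hsum : ∀ x, x = ∑ i, ⟪b i, x⟫ • a i) {x : E n}
    (hx : x ∈ frontier (hullBody a Finset.univ : Set (E n))) :
    (∃ i, ⟪b i, x⟫ = 0) ∨ ⟪∑ i, b i, x⟫ = 1 := by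
  by_contra! h
  have hxT : x ∈ hullBody a Finset.univ :=
    (hullBody a Finset.univ).isCompact.isClosed.frontier_subset hx
  rw [hullBody_eq_simplex hab hsum] at hxT
  have ho : IsOpen {x : E n | (∀ i, 0 < ⟪b i, x⟫) ∧ ⟪∑ i, b i, x⟫ < 1} := by
    rw [Set.ofPred_and, Set.ofPred_forall]
    exact (isOpen_iInter_of_finite fun i => isOpen_lt continuous_const (by fun_prop)).inter
      (isOpen_lt (by fun_prop) continuous_const)
  refine hx.2 (mem_interior.2 ⟨_, fun y hy => ?_, ho,
    ⟨fun i => (hxT.1 i).lt_of_ne (h.1 i).symm, hxT.2.lt_of_ne h.2⟩⟩)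
  exact (hullBody_eq_simplex hab hsum).2 ⟨fun i => (hy.1 i).le, hy.2.le⟩

theorem inner_sum_dual (hab : ∀ i j, ⟪b i, a j⟫ = if i = j then 1 else 0)
    (j : Fin n) : ⟪∑ i, b i, a j⟫ = 1 := by simp [sum_inner, hab]

/-- Relative interior points of the facet of the simplex opposite to `a i₀` are regular, with
outer normal `-b i₀`. -/
theorem mem_regularBoundary_of_mem_facet
    (hab : ∀ i j, ⟪b i, a j⟫ = if i = j then 1 else 0)
    (hsum : ∀ x, x = ∑ i, ⟪b i, x⟫ • a i) {i₀ : Fin n} (h0 : a i₀ = b i₀) {x : E n}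
    (hx0 : ⟪b i₀, x⟫ = 0) (hx : ∀ i, i ≠ i₀ → 0 < ⟪b i, x⟫) (hx1 : ⟪∑ i, b i, x⟫ < 1) :
    x ∈ regularBoundary (hullBody a Finset.univ) := by
  have hT := @hullBody_eq_simplex n a b hab hsum
  have hxT : x ∈ hullBody a Finset.univ := hT.2 ⟨fun i => by
    rcases eq_or_ne i i₀ with rfl | h
    · exact hx0.ge
    · exact (hx i h).le, hx1.le⟩
  -- From `x` the body extends in every direction `a i` and, for `i ≠ i₀`, also in direction `-a i`.
  -- Hence a normal is orthogonal to these `a i` and has nonpositive product with `a i₀`.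
  have hadd : ∀ i, x + (1 - ⟪∑ i, b i, x⟫) • a i ∈ hullBody a Finset.univ := fun i => by
    refine hT.2 ⟨fun j => ?_, ?_⟩
    · rw [inner_add_right, inner_smul_right, hab]
      refine add_nonneg ((hT.1 hxT).1 j) (mul_nonneg (by linarith) ?_)
      split_ifs <;> simp
    · rw [inner_add_right, inner_smul_right, inner_sum_dual hab]; linarith
  have hsub : ∀ i, i ≠ i₀ → x - ⟪b i, x⟫ • a i ∈ hullBody a Finset.univ := fun i hi => by
    refine hT.2 ⟨fun j => ?_, ?_⟩
    · rw [inner_sub_right, inner_smul_right, hab]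
      split_ifs with h
      · rw [h]; simp
      · simpa using (hT.1 hxT).1 j
    · rw [inner_sub_right, inner_smul_right, inner_sum_dual hab]; linarith [hx i hi]
  have key : ∀ u : S n, IsOuterNormal (hullBody a Finset.univ) x u → (u : E n) = -b i₀ := by
    intro u hu
    have h1 : ∀ i, ⟪a i, (u : E n)⟫ ≤ 0 := fun i => by
      have := hu _ (hadd i)
      rw [add_sub_cancel_left, real_inner_smul_left] at this
      exact nonpos_of_mul_nonpos_right this (by linarith)
    have h2 : ∀ i, i ≠ i₀ → ⟪a i, (u : E n)⟫ = 0 := fun i hi => by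
      have := hu _ (hsub i hi)
      rw [sub_sub_cancel_left, inner_neg_left, real_inner_smul_left] at this
      exact le_antisymm (h1 i) (by nlinarith [hx i hi])
    have hn : ⟪b i₀, b i₀⟫ = (1 : ℝ) := by
      conv_lhs => enter [3]; rw [← h0]
      simp [hab]
    have h3 : (u : E n) - ⟪b i₀, (u : E n)⟫ • b i₀ = 0 :=
      eq_zero_of_inner_eq_zero hsum fun i => by
        rcases eq_or_ne i i₀ with rfl | hi
        · rw [h0, inner_sub_right, inner_smul_right, hn]; ring
        · rw [inner_sub_right, inner_smul_right, h2 i hi, real_inner_comm (b i₀) (a i), hab, if_neg hi.symm]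
          simp
    have h4 : (u : E n) = ⟪b i₀, (u : E n)⟫ • b i₀ := sub_eq_zero.1 h3
    have h5 : ‖(u : E n)‖ = 1 := by simp
    have h6 : ‖b i₀‖ = 1 := by
      rw [real_inner_self_eq_norm_sq] at hn
      nlinarith [norm_nonneg (b i₀)]
    rw [h4, norm_smul, h6, mul_one, Real.norm_eq_abs, abs_of_nonpos (h0 ▸ h1 i₀)] at h5
    rw [h4, show ⟪b i₀, (u : E n)⟫ = -1 by linarith, neg_one_smul]
  have hnb : -b i₀ ≠ 0 := neg_ne_zero.2 (dual_ne_zero hab i₀)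
  have hout : IsOuterNormal (hullBody a Finset.univ) x (direction (-b i₀) hnb) :=
    isOuterNormal_direction hnb fun y hy => by
      rw [inner_neg_left, inner_neg_left, hx0]
      simpa using (hT.1 hy).1 i₀
  refine ⟨⟨subset_closure hxT, fun hint => ?_⟩, direction (-b i₀) hnb, hout, fun u hu =>
    Subtype.ext ((key u hu).trans (key _ hout).symm)⟩
  -- Points `x - s • a i₀` with `s > 0` violate `0 ≤ ⟪b i₀, ·⟫`, so `x` is not interior.
  have hc : Tendsto (fun s : ℝ => x - s • a i₀) (𝓝[>] 0) (𝓝 x) := by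
    have : Tendsto (fun s : ℝ => x - s • a i₀) (𝓝 0) (𝓝 (x - (0 : ℝ) • a i₀)) :=
      (by fun_prop : Continuous fun s : ℝ => x - s • a i₀).tendsto 0
    rw [zero_smul, sub_zero] at this
    exact this.mono_left nhdsWithin_le_nhds
  obtain ⟨s, hs, hs0⟩ :=
    ((hc.eventually (mem_interior_iff_mem_nhds.1 hint)).and self_mem_nhdsWithin).exists
  have := (hT.1 hs).1 i₀
  rw [inner_sub_right, inner_smul_right, hx0, hab, if_pos rfl] at this
  have : (0 : ℝ) < s := hs0
  linarith

end simplex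

/-- The odd functional of a simplex of which all facets but two have normals orthogonal to the
first coordinate direction. -/
theorem muOdd_simplex_le {m : ℕ} {a b : Fin (m + 1) → E (m + 1)}
    (hab : ∀ i j, ⟪b i, a j⟫ = if i = j then 1 else 0) (hsum : ∀ x, x = ∑ i, ⟪b i, x⟫ • a i)
    (ha0 : a 0 = EuclideanSpace.single 0 1) (hb0 : b 0 = EuclideanSpace.single 0 1)
    (hb : ∀ i, i ≠ 0 → (b i) 0 = 0) {R : ℝ} (hR : 0 ≤ R) (hRa : ∀ i, ‖a i‖ ≤ R) {C : ℝ≥0}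
    (hC : ∀ (w : E (m + 1)) (c : ℝ), w ≠ 0 →
      Measure.euclideanHausdorffMeasure m {x : E (m + 1) | ⟪w, x⟫ = c ∧ ‖x‖ ≤ R} ≤ C) :
    muOdd (Nat.succ_pos m) (hullBody a Finset.univ) ≤ (‖∑ i, b i‖⁻¹) ^ 3 * C -
      (Measure.euclideanHausdorffMeasure m {x : E (m + 1) | ⟪b 0, x⟫ = 0 ∧
        (∀ i, i ≠ 0 → 0 < ⟪b i, x⟫) ∧ ⟪∑ i, b i, x⟫ < 1}).toReal := by
  set T := hullBody a Finset.univ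
  set w := ∑ i, b i with hw
  have hT := @hullBody_eq_simplex _ a b hab hsum
  have hw0 : w 0 = 1 := by
    have h1 : ⟪w, a 0⟫ = 1 := inner_sum_dual hab 0
    rw [ha0, EuclideanSpace.inner_single_right] at h1
    simpa using h1
  have hwne : w ≠ 0 := fun h => by rw [h] at hw0; simp at hw0
  set A : Set (regularBoundary T) := {x | ⟪b 0, (x : E (m + 1))⟫ = 0} with hA
  set B : Set (regularBoundary T) := {x | ⟪w, (x : E (m + 1))⟫ = 1} with hB
  have hAm : MeasurableSet A := (isClosed_eq (by fun_prop) continuous_const).measurableSet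
  have hBm : MeasurableSet B := (isClosed_eq (by fun_prop) continuous_const).measurableSet
  have hmemT : ∀ x : regularBoundary T, (x : E (m + 1)) ∈ T := fun x =>
    T.isCompact.isClosed.frontier_subset x.2.1
  have hsmall : ∀ (D : Set (regularBoundary T)) (v : E (m + 1)) (c : ℝ), v ≠ 0 →
      (∀ x ∈ D, ⟪v, (x : E (m + 1))⟫ = c) → Measure.euclideanHausdorffMeasure m D ≤ C := by
    intro D v c hv hD
    rw [← (isometry_subtype_coe (s := regularBoundary T)).euclideanHausdorffMeasure_image]
    refine (measure_mono ?_).trans (hC v c hv)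
    rintro _ ⟨x, hx, rfl⟩
    exact ⟨hD x hx, norm_le_of_mem_hullBody hR hRa (hmemT x)⟩
  have hAC := hsmall A (b 0) 0 (dual_ne_zero hab 0) fun x hx => hx
  have hBC := hsmall B w 1 hwne fun x hx => hx
  have normal : ∀ (x : regularBoundary T) (v : E (m + 1)) (hv : v ≠ 0),
      (∀ y ∈ T, ⟪v, y⟫ ≤ ⟪v, (x : E (m + 1))⟫) →
      (gaussMap T x : E (m + 1)) 0 = ‖v‖⁻¹ * v 0 := fun x v hv h => by
    rw [gaussMap_eq x _ (isOuterNormal_direction hv h)]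
    simp [direction]
  have normal_b : ∀ (x : regularBoundary T) (i : Fin (m + 1)), ⟪b i, (x : E (m + 1))⟫ = 0 →
      (gaussMap T x : E (m + 1)) 0 = -(‖b i‖⁻¹ * (b i) 0) := fun x i h => by
    have := normal x (-b i) (neg_ne_zero.2 (dual_ne_zero hab i)) fun y hy => by
      rw [inner_neg_left, inner_neg_left, h]
      simpa using (hT.1 hy).1 i
    simpa using this
  have normal_w : ∀ x ∈ B, (gaussMap T x : E (m + 1)) 0 = ‖w‖⁻¹ := fun x hx => by
    have := normal x w hwne fun y hy => by
      rw [show ⟪w, (x : E (m + 1))⟫ = 1 from hx]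
      exact (hT.1 hy).2
    rwa [hw0, mul_one] at this
  have normal_A : ∀ x ∈ A, (gaussMap T x : E (m + 1)) 0 = -1 := fun x hx => by
    rw [normal_b x 0 hx, hb0]; simp
  have hwpos : 0 < ‖w‖⁻¹ := inv_pos.2 (norm_pos_iff.2 hwne)
  -- The normal at a regular point is unique, so any facet through the point determines it;
  -- intersections of facets need no separate treatment.
  have hpt : ∀ x : regularBoundary T, (gaussMap T x : E (m + 1)) ⟨0, Nat.succ_pos m⟩ ^ 3 =
      B.indicator (fun _ => (‖w‖⁻¹) ^ 3) x - A.indicator (fun _ => (1 : ℝ)) x := fun x => by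
    change (gaussMap T x : E (m + 1)) 0 ^ 3 = _
    by_cases hxA : x ∈ A
    · have hxB : x ∉ B := fun hxB => by
        have h1 := normal_w x hxB
        rw [normal_A x hxA] at h1
        linarith
      rw [Set.indicator_of_mem hxA, Set.indicator_of_notMem hxB, normal_A x hxA]; norm_num
    · rw [Set.indicator_of_notMem hxA, sub_zero]
      by_cases hxB : x ∈ B
      · rw [Set.indicator_of_mem hxB, normal_w x hxB]
      · rw [Set.indicator_of_notMem hxB]
        rcases mem_face_of_mem_frontier hab hsum x.2.1 with ⟨i, hi⟩ | h
        · have hi0 : i ≠ 0 := by rintro rfl; exact hxA hi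
          rw [normal_b x i hi, hb i hi0]; simp
        · exact absurd h hxB
  have hfin : ∀ {D : Set (regularBoundary T)}, Measure.euclideanHausdorffMeasure m D ≤ C →
      Measure.euclideanHausdorffMeasure m D ≠ ∞ := fun h => (h.trans_lt ENNReal.coe_lt_top).ne
  rw [(muOdd_eq_integral_gaussMap (Nat.succ_pos m) (K := T) (hullBody_nondegenerate hsum)).trans
    (integral_congr_ae (ae_of_all _ hpt))]
  rw [integral_sub ((integrable_indicator_iff hBm).2 (integrableOn_const (hfin hBC)))
    ((integrable_indicator_iff hAm).2 (integrableOn_const (hfin hAC))),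
    integral_indicator_const _ hBm, integral_indicator_const _ hAm, smul_eq_mul, smul_eq_mul,
    mul_one, mul_comm]
  refine sub_le_sub (mul_le_mul_of_nonneg_left ?_ (by positivity)) ?_
  · exact ENNReal.toReal_le_of_le_ofReal C.2 (by simpa using hBC)
  -- The area of `A` enters with a minus sign, so it suffices that relatively interior points of
  -- that facet are regular.
  · refine ENNReal.toReal_mono (hfin hAC) ?_
    rw [← (isometry_subtype_coe (s := regularBoundary T)).euclideanHausdorffMeasure_image]
    refine measure_mono fun x hx => ?_
    exact ⟨⟨x, mem_regularBoundary_of_mem_facet hab hsum (ha0.trans hb0.symm) hx.1 hx.2.1 hx.2.2⟩,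
      hx.1, rfl⟩

/-- Biorthogonality makes the `a i` independent, and `n` independent vectors span. -/
theorem eq_sum_of_biorthogonal {n : ℕ} {a b : Fin n → E n}
    (hab : ∀ i j, ⟪b i, a j⟫ = if i = j then 1 else 0) (x : E n) : x = ∑ i, ⟪b i, x⟫ • a i := by
  have hin : ∀ (c : Fin n → ℝ) (i : Fin n), ⟪b i, ∑ j, c j • a j⟫ = c i := fun c i => by
    simp [inner_sum, inner_smul_right, hab]
  have hli : LinearIndependent ℝ a := Fintype.linearIndependent_iff.2 fun c hc i => by
    rw [← hin c i, hc, inner_zero_right]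
  have hx := (hli.span_eq_top_of_card_eq_finrank' (by simp)).ge (Submodule.mem_top (x := x))
  obtain ⟨c, rfl⟩ := (Submodule.mem_span_range_iff_exists_fun ℝ).1 hx
  simp only [hin]

/-! ### Thin simplicial cones -/

section cones

variable {p : ℕ}

/-- The standard unit vectors of `ℝⁿ`. -/
def unitVec (i : Fin (p + 4)) : E (p + 4) := EuclideanSpace.single i 1

theorem inner_unitVec (i : Fin (p + 4)) (x : E (p + 4)) : ⟪unitVec i, x⟫ = x i := by
  simp [unitVec, EuclideanSpace.inner_single_left]

theorem unitVec_apply (i j : Fin (p + 4)) : (unitVec i) j = if i = j then 1 else 0 := by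
  simp [unitVec, eq_comm]

theorem norm_unitVec (i : Fin (p + 4)) : ‖unitVec i‖ = 1 := by simp [unitVec]

/-- The inner normals of the facets of a thin simplicial cone around the span of the first two
coordinate directions. -/
def coneNormal (k N : ℝ) : Fin (p + 4) → E (p + 4) :=
  Fin.cons (unitVec 0) (Fin.cons (((k + 1) / N) • unitVec 1 - ∑ j : Fin (p + 2), unitVec j.succ.succ)
    (Fin.cons (unitVec 2 - (k / N) • unitVec 1) fun j : Fin (p + 1) => unitVec j.succ.succ.succ))

/-- The generators of the cone with facet normals `coneNormal k N`. -/
def coneRay (k N : ℝ) : Fin (p + 4) → E (p + 4) :=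
  Fin.cons (unitVec 0) (Fin.cons (N • unitVec 1 + k • unitVec 2)
    fun j : Fin (p + 2) => unitVec j.succ.succ + (N • unitVec 1 + k • unitVec 2))

theorem inner_coneRay_zero (k N : ℝ) (x : E (p + 4)) : ⟪coneRay k N 0, x⟫ = x 0 := by
  simp [coneRay, inner_unitVec]

theorem inner_coneRay_one (k N : ℝ) (x : E (p + 4)) :
    ⟪coneRay k N 1, x⟫ = N * x 1 + k * x 2 := by
  change ⟪N • unitVec 1 + k • unitVec 2, x⟫ = _
  simp [inner_add_left, real_inner_smul_left, inner_unitVec]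

theorem inner_coneRay_succ_succ (k N : ℝ) (j : Fin (p + 2)) (x : E (p + 4)) :
    ⟪coneRay k N j.succ.succ, x⟫ = x j.succ.succ + (N * x 1 + k * x 2) := by
  simp [coneRay, inner_add_left, real_inner_smul_left, inner_unitVec]

theorem inner_coneNormal_one (k N : ℝ) (x : E (p + 4)) :
    ⟪coneNormal k N 1, x⟫ = (k + 1) / N * x 1 - ∑ j : Fin (p + 2), x j.succ.succ := by
  change ⟪((k + 1) / N) • unitVec 1 - ∑ j : Fin (p + 2), unitVec j.succ.succ, x⟫ = _
  simp [inner_sub_left, real_inner_smul_left, inner_unitVec, sum_inner]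

theorem inner_coneNormal_two (k N : ℝ) (x : E (p + 4)) :
    ⟪coneNormal k N 2, x⟫ = x 2 - k / N * x 1 := by
  change ⟪unitVec 2 - (k / N) • unitVec 1, x⟫ = _
  simp [inner_sub_left, real_inner_smul_left, inner_unitVec]

theorem inner_coneNormal_succ (k N : ℝ) (j : Fin (p + 1)) (x : E (p + 4)) :
    ⟪coneNormal k N j.succ.succ.succ, x⟫ = x j.succ.succ.succ := by
  simp [coneNormal, inner_unitVec]

theorem one_ne_zero_fin : (1 : Fin (p + 4)) ≠ 0 := Fin.succ_ne_zero (0 : Fin (p + 3))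

theorem two_ne_zero_fin : (2 : Fin (p + 4)) ≠ 0 := Fin.succ_ne_zero (1 : Fin (p + 3))

theorem succ_succ_ne_one (l : Fin (p + 2)) : l.succ.succ ≠ 1 := fun h =>
  Fin.succ_ne_zero l (Fin.succ_injective _ (h : l.succ.succ = (0 : Fin (p + 3)).succ))

theorem two_ne_one_fin : (2 : Fin (p + 4)) ≠ 1 := succ_succ_ne_one 0

theorem succ_succ_succ_ne_two (l : Fin (p + 1)) : l.succ.succ.succ ≠ 2 := fun h =>
  Fin.succ_ne_zero l (Fin.succ_injective _ (Fin.succ_injective _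
    (h : l.succ.succ.succ = (0 : Fin (p + 2)).succ.succ)))

theorem fin_cases_three (j : Fin (p + 4)) :
    j = 0 ∨ j = 1 ∨ j = 2 ∨ ∃ l : Fin (p + 1), j = l.succ.succ.succ := by
  refine j.cases (Or.inl rfl) fun j => j.cases (Or.inr (Or.inl rfl)) fun j =>
    j.cases (Or.inr (Or.inr (Or.inl rfl))) fun j => Or.inr (Or.inr (Or.inr ⟨j, rfl⟩))

theorem coneNormal_one (k N : ℝ) : coneNormal (p := p) k N 1 =
    ((k + 1) / N) • unitVec 1 - ∑ j : Fin (p + 2), unitVec j.succ.succ := rfl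

theorem coneNormal_two (k N : ℝ) :
    coneNormal (p := p) k N 2 = unitVec 2 - (k / N) • unitVec 1 := rfl

theorem coneNormal_succ (k N : ℝ) (j : Fin (p + 1)) :
    coneNormal (p := p) k N j.succ.succ.succ = unitVec j.succ.succ.succ := rfl

/-- The rays show the geometry: scaled to have coordinate `1` equal to one, all but the ray `unitVec
0` are `e₁ + (k/N) e₂`, possibly plus some `eⱼ/N`. -/
theorem inner_coneRay_coneNormal (k : ℝ) {N : ℝ} (hN : N ≠ 0) (i j : Fin (p + 4)) :
    ⟪coneRay k N i, coneNormal k N j⟫ = if i = j then 1 else 0 := by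
  have n10 := one_ne_zero_fin (p := p)
  have n20 := two_ne_zero_fin (p := p)
  have n21 := two_ne_one_fin (p := p)
  have s1 := succ_succ_ne_one (p := p)
  have s2 := succ_succ_succ_ne_two (p := p)
  have t2 : ∑ l : Fin (p + 2), (unitVec l.succ.succ : E (p + 4)) 2 = 1 := by
    rw [show (2 : Fin (p + 4)) = (0 : Fin (p + 2)).succ.succ from rfl]
    simp only [unitVec_apply, Fin.succ_inj]
    simp
  have key : (coneNormal k N j 0 = if 0 = j then 1 else 0) ∧
      (N * coneNormal k N j 1 + k * coneNormal k N j 2 = if 1 = j then 1 else 0) ∧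
      ∀ l : Fin (p + 2), coneNormal k N j l.succ.succ =
        (if l.succ.succ = j then 1 else 0) - (if 1 = j then 1 else 0) := by
    rcases fin_cases_three j with rfl | rfl | rfl | ⟨j, rfl⟩
    · refine ⟨?_, ?_, fun l => ?_⟩ <;>
        simp [coneNormal, unitVec_apply, n10, n10.symm, n20.symm, (Fin.succ_ne_zero _).symm]
    · rw [coneNormal_one]
      refine ⟨?_, ?_, fun l => ?_⟩
      · simp [unitVec_apply, n10, n10.symm]
      · simp only [PiLp.sub_apply, PiLp.smul_apply, WithLp.ofLp_sum, Finset.sum_apply, t2]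
        simp [unitVec_apply, s1, n21.symm]
        field_simp
        ring
      · simp [unitVec_apply, s1, (s1 _).symm]
    · rw [coneNormal_two]
      refine ⟨?_, ?_, fun l => ?_⟩
      · simp [unitVec_apply, n10, n20, n20.symm]
      · simp [unitVec_apply, n21, n21.symm]
        field_simp
        ring
      · simp [unitVec_apply, n21.symm, (s1 _).symm, eq_comm]
    · rw [coneNormal_succ]
      refine ⟨?_, ?_, fun l => ?_⟩
      · simp [unitVec_apply, Fin.succ_ne_zero, (Fin.succ_ne_zero _).symm]
      · simp [unitVec_apply, s1, s2, (s1 _).symm]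
      · simp [unitVec_apply, (s1 _).symm, eq_comm]
  obtain ⟨h0, h1, h2⟩ := key
  refine i.cases ?_ fun i => i.cases ?_ fun i => ?_
  · rw [inner_coneRay_zero, h0]
  · change ⟪coneRay k N 1, _⟫ = if 1 = j then 1 else 0
    rw [inner_coneRay_one, h1]
  · rw [inner_coneRay_succ_succ, h1, h2, sub_add_cancel]

theorem norm_coneNormal_le {k N : ℝ} (hN : 0 < N) (hk : 0 ≤ k) (hkN : k + 1 ≤ N)
    (i : Fin (p + 4)) : ‖coneNormal k N i‖ ≤ p + 4 := by
  have h1 : |(k + 1) / N| ≤ 1 := by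
    rw [abs_of_nonneg (by positivity)]; exact (div_le_one hN).2 hkN
  have h2 : |k / N| ≤ 1 := by
    rw [abs_of_nonneg (by positivity)]; exact (div_le_one hN).2 (by linarith)
  have hp : (0 : ℝ) ≤ p := p.cast_nonneg
  refine i.cases ?_ fun i => i.cases ?_ fun i => i.cases ?_ fun i => ?_
  · simp only [coneNormal, Fin.cons_zero, norm_unitVec]; linarith
  · simp only [coneNormal, Fin.cons_zero, Fin.cons_succ]
    refine (norm_sub_le _ _).trans ?_
    have h3 : ‖∑ j : Fin (p + 2), unitVec j.succ.succ‖ ≤ (p + 2 : ℝ) := by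
      refine (norm_sum_le _ _).trans ?_
      simp [norm_unitVec]
    rw [norm_smul, norm_unitVec, Real.norm_eq_abs]
    linarith
  · simp only [coneNormal, Fin.cons_zero, Fin.cons_succ]
    refine (norm_sub_le _ _).trans ?_
    rw [norm_smul, norm_unitVec, norm_unitVec, Real.norm_eq_abs]
    linarith
  · simp only [coneNormal, Fin.cons_succ, norm_unitVec]; linarith

/-- These come from the normals with indices `3`, `2` and `1`; in the last one the further, positive
coordinates are dropped from the sum. -/
theorem of_coneLip_pos {k N : ℝ} (hN : 0 < N) {x : S (p + 4)}
    (h : 0 < coneLip (coneNormal k N) x) :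
    0 < (x : E (p + 4)) 3 ∧ k * (x : E (p + 4)) 1 < N * (x : E (p + 4)) 2 ∧
      N * ((x : E (p + 4)) 2 + (x : E (p + 4)) 3) < (k + 1) * (x : E (p + 4)) 1 := by
  have h1 := inner_pos_of_coneLip_pos h 1
  have h2 := inner_pos_of_coneLip_pos h 2
  have h3 : ∀ j : Fin (p + 1), 0 < (x : E (p + 4)) j.succ.succ.succ := fun j => by
    rw [← inner_coneNormal_succ k N]; exact inner_pos_of_coneLip_pos h _
  rw [inner_coneNormal_one, Fin.sum_univ_succ, Fin.sum_univ_succ] at h1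
  rw [inner_coneNormal_two] at h2
  have h4 : 0 ≤ ∑ j : Fin p, (x : E (p + 4)) j.succ.succ.succ.succ :=
    Finset.sum_nonneg fun j _ => (h3 j.succ).le
  have h5 : (x : E (p + 4)) 2 + (x : E (p + 4)) 3 < (k + 1) / N * (x : E (p + 4)) 1 := by
    change 0 < _ - ((x : E (p + 4)) 2 + ((x : E (p + 4)) 3 + _)) at h1
    linarith
  refine ⟨h3 0, ?_, ?_⟩
  · have := mul_pos hN h2
    have e : N * ((x : E (p + 4)) 2 - k / N * (x : E (p + 4)) 1) =
        N * (x : E (p + 4)) 2 - k * (x : E (p + 4)) 1 := by field_simp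
    linarith
  · have := mul_lt_mul_of_pos_left h5 hN
    have e : N * ((k + 1) / N * (x : E (p + 4)) 1) = (k + 1) * (x : E (p + 4)) 1 := by field_simp
    linarith

/-- Combining the two slope inequalities gives `N x₃ < x₁ ≤ 1`. -/
theorem apply_three_lt_of_coneLip_pos {k N : ℝ} (hN : 0 < N) {x : S (p + 4)}
    (h : 0 < coneLip (coneNormal k N) x) : (x : E (p + 4)) 3 < 1 / N := by
  obtain ⟨-, h1, h2⟩ := of_coneLip_pos hN h
  have h3 : (x : E (p + 4)) 1 ≤ 1 := by
    have := PiLp.norm_apply_le (x : E (p + 4)) 1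
    rw [norm_eq_of_mem_sphere] at this
    exact (le_abs_self _).trans this
  rw [lt_div_iff₀ hN]
  nlinarith

theorem coneLip_le_inv {k N : ℝ} (hN : 0 < N) (x : S (p + 4)) :
    coneLip (coneNormal k N) x ≤ 1 / N := by
  rcases (coneLip_nonneg (coneNormal k N) x).eq_or_lt with h | h
  · rw [← h]; positivity
  · have h1 := coneLip_le (coneNormal k N) x (0 : Fin (p + 1)).succ.succ.succ
    rw [inner_coneNormal_succ] at h1
    exact h1.trans (max_le (by positivity) (apply_three_lt_of_coneLip_pos hN h).le)

/-- A common point of positivity has `x₁ > 0`, and then `N x₂ < (k + 1) x₁ ≤ l x₁ < N x₂`. -/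
theorem coneLip_inf_coneLip {k l : ℕ} (hkl : k ≠ l) {N : ℝ} (hN : 0 < N) :
    coneLip (coneNormal (p := p) k N) ⊓ coneLip (coneNormal l N) = 0 := by
  wlog h : k < l generalizing k l
  · rw [inf_comm]; exact this hkl.symm (by omega)
  ext x
  rw [Lip.inf_apply, Lip.zero_apply]
  refine le_antisymm ?_ (le_inf (coneLip_nonneg _ x) (coneLip_nonneg _ x))
  by_contra! hlt
  obtain ⟨hk, hl⟩ := lt_inf_iff.1 hlt
  obtain ⟨h1, h2, h3⟩ := of_coneLip_pos hN hk
  obtain ⟨h4, h5, h6⟩ := of_coneLip_pos hN hl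
  have h7 : (k : ℝ) + 1 ≤ l := by exact_mod_cast h
  have h8 : 0 < N * (x : E (p + 4)) 3 := mul_pos hN h1
  have h9 : 0 < (x : E (p + 4)) 1 := by nlinarith
  nlinarith

end cones

/-! ### Lower bound for the area of a facet -/

/-- The matrix of the shear `z ↦ (N z₀ + k z₁, z₁, z₂, …)`. -/
def shearMatrix (q : ℕ) (k N : ℝ) : Matrix (Fin (q + 2)) (Fin (q + 2)) ℝ :=
  Matrix.of (Fin.cons (Fin.cons N (Fin.cons k 0)) fun i j => if i.succ = j then 1 else 0)

theorem det_shearMatrix (q : ℕ) (k N : ℝ) : (shearMatrix q k N).det = N := by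
  rw [Matrix.det_of_isUpperTriangular]
  · rw [Fin.prod_univ_succ]
    simp [shearMatrix]
  · intro i j hij
    revert hij
    refine i.cases (fun h => absurd h (Fin.not_lt_zero j)) fun i h => ?_
    have : i.succ ≠ j := ne_of_gt h
    simp [shearMatrix, this]

theorem shearMatrix_mulVec_zero (q : ℕ) (k N : ℝ) (z : Fin (q + 2) → ℝ) :
    (shearMatrix q k N).mulVec z 0 = N * z 0 + k * z 1 := by
  simp [Matrix.mulVec, dotProduct, Fin.sum_univ_succ, shearMatrix]

theorem shearMatrix_mulVec_succ (q : ℕ) (k N : ℝ) (z : Fin (q + 2) → ℝ) (i : Fin (q + 1)) :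
    (shearMatrix q k N).mulVec z i.succ = z i.succ := by
  simp [Matrix.mulVec, dotProduct, shearMatrix]

/-- The set is the preimage of a fixed box under a shear of determinant `N`, hence `c` is
independent of `k`. -/
theorem exists_volume_sheared_box (q : ℕ) {δ : ℝ} (hδ : 0 < δ) :
    ∃ c : ℝ≥0, 0 < c ∧ ∀ k N : ℝ, 0 < N →
      volume {z : E (q + 2) | (δ < N * z 0 + k * z 1 ∧ N * z 0 + k * z 1 < 2 * δ) ∧
        ∀ i : Fin (q + 1), -δ < z i.succ ∧ z i.succ < δ} = ENNReal.ofReal N⁻¹ * c := by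
  set B : Set (Fin (q + 2) → ℝ) := Set.pi Set.univ fun i =>
    Set.Ioo ((Fin.cons δ fun _ => -δ : Fin (q + 2) → ℝ) i)
      ((Fin.cons (2 * δ) fun _ => δ : Fin (q + 2) → ℝ) i) with hB
  have hvol : volume B = ENNReal.ofReal δ * ENNReal.ofReal (2 * δ) ^ (q + 1) := by
    rw [hB, Real.volume_pi_Ioo, Fin.prod_univ_succ]
    simp [two_mul]
  have hfin : volume B ≠ ∞ := by
    rw [hvol]; exact ENNReal.mul_ne_top ENNReal.ofReal_ne_top (ENNReal.pow_ne_top ENNReal.ofReal_ne_top)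
  have hpos : volume B ≠ 0 := by
    rw [hvol]
    exact mul_ne_zero (ENNReal.ofReal_pos.2 hδ).ne'
      (pow_ne_zero _ (ENNReal.ofReal_pos.2 (by positivity)).ne')
  refine ⟨(volume B).toNNReal, ENNReal.toNNReal_pos hpos hfin, fun k N hN => ?_⟩
  rw [ENNReal.coe_toNNReal hfin]
  have hdet : LinearMap.det (Matrix.toLin' (shearMatrix q k N)) = N := by
    rw [LinearMap.det_toLin', det_shearMatrix]
  have h1 := Measure.addHaar_preimage_linearMap (volume : Measure (Fin (q + 2) → ℝ))
    (f := Matrix.toLin' (shearMatrix q k N)) (by rw [hdet]; exact hN.ne') B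
  rw [hdet, abs_of_pos (inv_pos.2 hN)] at h1
  rw [← h1, ← (EuclideanSpace.volume_preserving_symm_measurableEquiv_toLp
    (Fin (q + 2))).measure_preimage_equiv]
  congr 1
  ext z
  simp only [Set.mem_preimage, hB, Set.mem_pi, Set.mem_univ, true_implies, Fin.forall_fin_succ,
    Set.mem_Ioo, Fin.cons_zero, Fin.cons_succ, Matrix.toLin'_apply, shearMatrix_mulVec_zero,
    shearMatrix_mulVec_succ]
  rfl

theorem isometry_cons_zero (m : ℕ) :
    Isometry fun z : E m => (WithLp.toLp 2 (Fin.cons 0 z : Fin (m + 1) → ℝ) : E (m + 1)) := by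
  refine Isometry.of_dist_eq fun x y => ?_
  rw [EuclideanSpace.dist_eq, EuclideanSpace.dist_eq, Fin.sum_univ_succ]
  simp

theorem exists_le_hausdorffMeasure_facet (p : ℕ) :
    ∃ c : ℝ≥0, 0 < c ∧ ∀ k N : ℝ, 0 < N → ENNReal.ofReal N⁻¹ * c ≤
      Measure.euclideanHausdorffMeasure (p + 3) {x : E (p + 4) | ⟪coneRay k N 0, x⟫ = 0 ∧
        (∀ i, i ≠ 0 → 0 < ⟪coneRay k N i, x⟫) ∧ ⟪∑ i, coneRay k N i, x⟫ < 1} := by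
  -- On the box, the sum of all products with the rays is below `2δ + (p + 2) · 3δ = (3p + 8) δ`.
  have hδ : (0 : ℝ) < 1 / (3 * p + 8) := by positivity
  obtain ⟨c, hc, h⟩ := exists_volume_sheared_box (p + 1) hδ
  refine ⟨c, hc, fun k N hN => ?_⟩
  rw [← h k N hN, ← EuclideanSpace.euclideanHausdorffMeasure_eq_volume,
    ← (isometry_cons_zero (p + 3)).euclideanHausdorffMeasure_image]
  refine measure_mono ?_
  rintro _ ⟨z, ⟨hz0, hz⟩, rfl⟩
  set x : E (p + 4) := WithLp.toLp 2 (Fin.cons 0 z : Fin (p + 4) → ℝ) with hx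
  have h0 : ⟪coneRay k N 0, x⟫ = 0 := inner_coneRay_zero k N x
  have h1 : ⟪coneRay k N 1, x⟫ = N * z 0 + k * z 1 := inner_coneRay_one k N x
  have h2 : ∀ j : Fin (p + 2), ⟪coneRay k N j.succ.succ, x⟫ = z j.succ + (N * z 0 + k * z 1) :=
    fun j => inner_coneRay_succ_succ k N j x
  refine ⟨h0, fun i => ?_, ?_⟩
  · refine i.cases (fun h => absurd rfl h) fun i => i.cases (fun _ => ?_) fun i _ => ?_
    · exact h1 ▸ hδ.trans hz0.1
    · rw [h2]; linarith [(hz i).1, hz0.1]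
  · rw [sum_inner, Fin.sum_univ_succ, Fin.sum_univ_succ, h0]
    rw [show (0 : Fin (p + 3)).succ = (1 : Fin (p + 4)) from rfl]
    change 0 + (⟪coneRay k N 1, x⟫ + ∑ j : Fin (p + 2), ⟪coneRay k N j.succ.succ, x⟫) < 1
    rw [h1, Finset.sum_congr rfl fun j _ => h2 j]
    have h3 : ∑ j : Fin (p + 2), (z j.succ + (N * z 0 + k * z 1)) ≤
        ∑ _j : Fin (p + 2), 3 * (1 / (3 * p + 8) : ℝ) :=
      Finset.sum_le_sum fun j _ => by linarith [(hz j).2, hz0.2]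
    rw [Finset.sum_const, Finset.card_univ, Fintype.card_fin, nsmul_eq_mul] at h3
    have h4 : ((p + 2 : ℕ) : ℝ) * (3 * (1 / (3 * p + 8) : ℝ)) + 2 * (1 / (3 * p + 8) : ℝ) = 1 := by
      push_cast
      field_simp
      ring
    linarith [hz0.2]

theorem exists_muOdd_le (p : ℕ) : ∃ C c : ℝ, 0 < c ∧ ∀ k N : ℝ, 0 < N → 0 ≤ k → k + 1 ≤ N →
    muOdd (Nat.succ_pos (p + 3)) (hullBody (coneNormal k N) Finset.univ) ≤
      C * (N⁻¹) ^ 3 - c * N⁻¹ := by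
  -- The radius `p + 4` bounds the norms of all the vertices, uniformly in `k` and `N`.
  obtain ⟨C, hC⟩ := exists_hausdorffMeasure_hyperplane_le (p + 3) (p + 4)
  obtain ⟨c, hc, hf⟩ := exists_le_hausdorffMeasure_facet p
  refine ⟨C, c, hc, fun k N hN hk hkN => ?_⟩
  have hab := inner_coneRay_coneNormal (p := p) k hN.ne'
  have hsum := eq_sum_of_biorthogonal hab
  have hR : (0 : ℝ) ≤ (p + 4 : ℝ) := by positivity
  have hle := muOdd_simplex_le hab hsum rfl rfl (fun i => ?_) hR (norm_coneNormal_le hN hk hkN) hC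
  · refine hle.trans (sub_le_sub ?_ ?_)
    · rw [mul_comm]
      refine mul_le_mul_of_nonneg_left (pow_le_pow_left₀ (by positivity) ?_ 3) C.2
      refine inv_anti₀ hN ?_
      -- Every ray except the one with index `0` has coordinate `1` equal to `N`, so the sum has
      -- norm at least `N`.
      have h1 := PiLp.norm_apply_le (∑ i, coneRay (p := p) k N i) 1
      refine le_trans ?_ h1
      rw [← inner_unitVec, real_inner_comm, sum_inner, Fin.sum_univ_succ, Fin.sum_univ_succ]
      simp only [inner_coneRay_succ_succ]
      rw [show (0 : Fin (p + 3)).succ = (1 : Fin (p + 4)) from rfl, inner_coneRay_one,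
        inner_coneRay_zero]
      refine le_trans ?_ (le_abs_self _)
      simp [unitVec_apply, two_ne_one_fin.symm, (succ_succ_ne_one _).symm]
      positivity
    · have hfin : Measure.euclideanHausdorffMeasure (p + 3) {x : E (p + 4) |
          ⟪coneRay k N 0, x⟫ = 0 ∧ (∀ i, i ≠ 0 → 0 < ⟪coneRay k N i, x⟫) ∧
            ⟪∑ i, coneRay k N i, x⟫ < 1} ≠ ∞ := by
        refine ((measure_mono fun x hx => ?_).trans_lt
          ((hC (coneRay k N 0) 0 (dual_ne_zero hab 0)).trans_lt ENNReal.coe_lt_top)).ne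
        refine ⟨hx.1, norm_le_of_mem_hullBody hR (norm_coneNormal_le hN hk hkN)
          ((hullBody_eq_simplex hab hsum).2 ⟨fun i => ?_, hx.2.2.le⟩)⟩
        rcases eq_or_ne i 0 with rfl | hi
        · exact hx.1.ge
        · exact (hx.2.1 i hi).le
      have := ENNReal.toReal_mono hfin (hf k N hN)
      rwa [ENNReal.toReal_mul, ENNReal.toReal_ofReal (inv_pos.2 hN).le, ENNReal.coe_toReal,
        mul_comm] at this
  · refine i.cases (fun h => absurd rfl h) fun i => i.cases (fun _ => ?_) fun i _ => ?_
    · simp [coneRay, unitVec_apply, two_ne_zero_fin]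
    · simp [coneRay, unitVec_apply, two_ne_zero_fin]

/-! ### Many bumps on thin cones -/

/-- The maximum of `N + 1` functions supported on thin cones with disjoint interiors. -/
def bumps (p N : ℕ) : Lip (p + 4) :=
  (Finset.range (N + 1)).sup' Finset.nonempty_range_add_one fun k =>
    coneLip (coneNormal (k : ℝ) ((N + 1 : ℕ) : ℝ))

theorem exists_bumps_apply_eq (p N : ℕ) (x : S (p + 4)) :
    ∃ k : ℕ, bumps p N x = coneLip (coneNormal (k : ℝ) ((N + 1 : ℕ) : ℝ)) x := by
  rw [bumps, Lip.sup'_apply]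
  obtain ⟨k, -, hk⟩ := Finset.exists_mem_eq_sup' (s := Finset.range (N + 1))
    Finset.nonempty_range_add_one fun k : ℕ =>
      coneLip (coneNormal (p := p) (k : ℝ) ((N + 1 : ℕ) : ℝ)) x
  exact ⟨k, hk⟩

/-- A point with `x₃ ≤ 0` lies in none of the open cones, and one with `x₃ > 0` in none as soon as
`1 / (N + 1) < x₃`. -/
theorem tauConverges_bumps (p : ℕ) : TauConverges (bumps p) 0 := by
  have hpos : ∀ N : ℕ, (0 : ℝ) < ((N + 1 : ℕ) : ℝ) := fun N => by positivity
  have hnn : ∀ N x, 0 ≤ bumps p N x := fun N x => by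
    obtain ⟨k, hk⟩ := exists_bumps_apply_eq p N x
    rw [hk]; exact coneLip_nonneg _ x
  have hlim : Tendsto (fun N : ℕ => 1 / ((N + 1 : ℕ) : ℝ)) atTop (𝓝 0) := by
    simpa using tendsto_one_div_add_atTop_nhds_zero_nat (𝕜 := ℝ)
  refine tauConverges_zero (C := p + 4) (fun N => ?_) hnn ?_ fun x => ?_
  · refine Lip.lipschitzWith_sup' _ _ _ fun k hk => lipschitzWith_coneLip fun i => ?_
    rw [← NNReal.coe_le_coe, coe_nnnorm]
    push_cast
    refine norm_coneNormal_le (by positivity) (by positivity) ?_ i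
    have := Finset.mem_range.1 hk
    exact_mod_cast this
  · rw [Metric.tendstoUniformly_iff]
    intro ε hε
    filter_upwards [hlim.eventually_lt_const hε] with N hN x
    obtain ⟨k, hk⟩ := exists_bumps_apply_eq p N x
    rw [Lip.zero_apply, dist_comm, Real.dist_eq, sub_zero, abs_of_nonneg (hnn N x), hk]
    exact (coneLip_le_inv (hpos N) x).trans_lt hN
  · rcases le_or_gt ((x : E (p + 4)) 3) 0 with h | h
    · refine Eventually.of_forall fun N => ?_
      obtain ⟨k, hk⟩ := exists_bumps_apply_eq p N x
      by_contra hne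
      have := of_coneLip_pos (hpos N) (hk ▸ (hnn N x).lt_of_ne (Ne.symm hne))
      exact absurd this.1 h.not_gt
    · filter_upwards [hlim.eventually_lt_const h] with N hN
      obtain ⟨k, hk⟩ := exists_bumps_apply_eq p N x
      by_contra hne
      have := apply_three_lt_of_coneLip_pos (hpos N) (hk ▸ (hnn N x).lt_of_ne (Ne.symm hne))
      exact absurd this hN.not_gt

end LipVal

end

/-! ### The contradiction -/

theorem mainTheorem2 (n : ℕ) (hn : 4 ≤ n) :
    ¬ ∃ ν ∈ LipVal.Val n (n - 1), ∀ K : ConvexBody (LipVal.E n),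
      ν (LipVal.supportLip K) = ((LipVal.muOdd (by omega) K : ℝ) : ℂ) := by
  rintro ⟨ν, ⟨hν, -⟩, hK⟩
  obtain ⟨p, rfl⟩ := Nat.exists_eq_add_of_le' hn
  have hz : ν 0 = 0 := by
    rw [← LipVal.supportLip_hullBody_empty (fun i : Fin (p + 4) => (0 : LipVal.E (p + 4))), hK,
      LipVal.muOdd_hullBody_eq_zero _ (Finset.empty_ssubset.2 Finset.univ_nonempty),
      Complex.ofReal_zero]
  obtain ⟨C, c, hc, hμ⟩ := LipVal.exists_muOdd_le p
  -- The prefactor cancels the sign from the inclusion–exclusion, which is the same for all cones.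
  have hsum : ∀ N : ℕ, (-1) ^ (p + 4 + 1) * ν (LipVal.bumps p N) =
      ((∑ k ∈ Finset.range (N + 1), LipVal.muOdd (Nat.succ_pos (p + 3)) (LipVal.hullBody
        (LipVal.coneNormal (k : ℝ) ((N + 1 : ℕ) : ℝ)) Finset.univ) : ℝ) : ℂ) := fun N => by
    rw [LipVal.bumps, LipVal.valuation_sup'_of_disjoint hν.valuation 0 hz _ _ _
      fun i _ j _ hij => LipVal.coneLip_inf_coneLip hij (Nat.cast_pos.2 N.succ_pos), Finset.mul_sum,
      Complex.ofReal_sum]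
    refine Finset.sum_congr rfl fun k _ => ?_
    rw [LipVal.valuation_coneLip _ hν hK, ← mul_assoc, ← mul_pow, neg_one_mul, neg_neg, one_pow,
      one_mul]
  have hlim := ((LipVal.tauConverges_bumps p).tendsto hν.continuous).const_mul
    ((-1 : ℂ) ^ (p + 4 + 1))
  rw [hz, mul_zero] at hlim
  simp only [hsum] at hlim
  have hlim' := (Complex.continuous_re.tendsto _).comp hlim
  simp only [Function.comp_def, Complex.ofReal_re, Complex.zero_re] at hlim'
  have hinv : Filter.Tendsto (fun N : ℕ => (((N + 1 : ℕ) : ℝ))⁻¹) Filter.atTop (nhds 0) := by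
    simpa using tendsto_one_div_add_atTop_nhds_zero_nat (𝕜 := ℝ)
  have hbound : Filter.Tendsto (fun N : ℕ => C * (((N + 1 : ℕ) : ℝ))⁻¹ ^ 2 - c) Filter.atTop
      (nhds (C * 0 ^ 2 - c)) := ((hinv.pow 2).const_mul C).sub_const c
  -- There are `N + 1` terms, which turns `C (N+1)⁻³ - c (N+1)⁻¹` into `C (N+1)⁻² - c`; in the limit
  -- `0 ≤ -c`.
  have := le_of_tendsto_of_tendsto' hlim' hbound fun N => by
    have hN : (0 : ℝ) < ((N + 1 : ℕ) : ℝ) := by positivity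
    have h1 : ∀ k ∈ Finset.range (N + 1), LipVal.muOdd (Nat.succ_pos (p + 3)) (LipVal.hullBody
        (LipVal.coneNormal (k : ℝ) ((N + 1 : ℕ) : ℝ)) Finset.univ) ≤
          C * (((N + 1 : ℕ) : ℝ))⁻¹ ^ 3 - c * (((N + 1 : ℕ) : ℝ))⁻¹ := fun k hk => by
      refine hμ k _ hN k.cast_nonneg ?_
      have := Finset.mem_range.1 hk
      exact_mod_cast this
    refine (Finset.sum_le_sum h1).trans_eq ?_
    rw [Finset.sum_const, Finset.card_range, nsmul_eq_mul]
    field_simp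
  norm_num at this
  linarith
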